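/- Let $L,P,K$ be finite sets (edges, operators, line pools). Let $c_\ell>0$ be the capacity of edge $\ell\in L$, and for each $k\in K$ let $R(k)\in\{0,1\}^{L\times P}$ be the routing matrix of pool $k$. Fix bids $w_{p,k}\ge 0$ and capacity proportions $f_k>0$. For a price vector $\Lambda=(\Lambda_{\ell,k})\ge 0$ put $\mu_{p,k}(\Lambda)=\sum_{\ell}\Lambda_{\ell,k}R_{\ell,p}(k)$, $x_{p,k}(\Lambda)=w_{p,k}/\mu_{p,k}(\Lambda)$ (read as $0$ if $w_{p,k}=0$) and $y_{\ell,k}(\Lambda)=\sum_p R_{\ell,p}(k)\,x_{p,k}(\Lambda)$. Consider the convex program, with $w$ and $f$ fixed and $0\log 0=0$, $$\max \sum_{p,k} w_{p,k}\log x_{p,k}\quad\text{s.t.}\quad \sum_{p}R_{\ell,p}(k)\,x_{p,k}\le c_\ell f_k\ \ \forall(\ell,k),\qquad x\ge 0 .$$ Call $\bar\Lambda\ge 0$ an optimal price vector for $(w,f)$ if it is a vector of Lagrange multipliers of the capacity constraints at an optimal solution $\bar x$ of this program, that is, $\mu_{p,k}(\bar\Lambda)\,\bar x_{p,k}=w_{p,k}$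 for all $(p,k)$ and $\bar\Lambda_{\ell,k}\bigl(\sum_p R_{\ell,p}(k)\bar x_{p,k}-c_\ell f_k\bigr)=0$ for all $(\ell,k)$. Let $\Lambda:[0,\infty)\to\mathbb{R}_{\ge 0}^{L\times K}$ be any solution of the resource price updating scheme: $\Lambda$ is absolutely continuous on bounded intervals and, for almost every $t>0$, one has $\mu_{p,k}(\Lambda(t))>0$ whenever $w_{p,k}>0$, and for all $(\ell,k)$ $$\dot\Lambda_{\ell,k}(t)=\begin{cases} y_{\ell,k}(\Lambda(t))-c_\ell f_k & \text{if }\Lambda_{\ell,k}(t)>0,\\ \max\{0,\;y_{\ell,k}(\Lambda(t))-c_\ell f_k\} & \text{if }\Lambda_{\ell,k}(t)=0.\end{cases}$$ Then, as $t\to\infty$, $\Lambda(t)$ converges to an optimal price vector for $(w,f)$ (so to the optimal price vector, whenever it is unique). Moreover, for every optimal price vector $\bar\Lambda$ for $(w,f)$, the function $t\mapsto \tfrac12\|\Lambda(t)-\bar\Lambda\|^2$ (Euclidean norm) is nonincreasing on $[0,\infty)$. -/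

import Mathlib

namespace LinePlanning

noncomputable section

/-- End-to-end unit price `μ_{p,k}(Λ) = ∑_ℓ Λ_{ℓ,k} R_{ℓ,p}(k)` of the line of operator `p`
in pool `k`. -/
def pathPrice {L P K : Type*} [Fintype L] (R : K → Matrix L P ℝ) (Λ : L → K → ℝ)
    (p : P) (k : K) : ℝ :=
  ∑ ℓ, Λ ℓ k * R k ℓ p

/-- Aggregate frequency `y_{ℓ,k} = ∑_p R_{ℓ,p}(k) x_{p,k}` on edge `ℓ` in pool `k`. -/
def edgeLoad {L P K : Type*} [Fintype P] (R : K → Matrix L P ℝ) (x : P → K → ℝ)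
    (ℓ : L) (k : K) : ℝ :=
  ∑ p, R k ℓ p * x p k

/-- Frequency `x_{p,k} = w_{p,k} / μ_{p,k}(Λ)` bought with the bid `w_{p,k}` at prices `Λ`.
A zero bid buys frequency `0`, whatever the price. For a positive bid the quotient is only used
at positive `μ_{p,k}(Λ)`, see `IsPriceTrajectory`. -/
def boughtFrequency {L P K : Type*} [Fintype L] (R : K → Matrix L P ℝ) (w : P → K → ℝ)
    (Λ : L → K → ℝ) (p : P) (k : K) : ℝ :=
  w p k / pathPrice R Λ p k

/-- Right-hand side of the projected price updating scheme at a nonnegative price vector `Λ`: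
`y_{ℓ,k} - c_ℓ f_k` where `Λ_{ℓ,k} > 0`, and `max {0, y_{ℓ,k} - c_ℓ f_k}` where
`Λ_{ℓ,k} = 0`. -/
def priceVelocity {L P K : Type*} [Fintype L] [Fintype P] (R : K → Matrix L P ℝ) (c : L → ℝ)
    (w : P → K → ℝ) (f : K → ℝ) (Λ : L → K → ℝ) (ℓ : L) (k : K) : ℝ :=
  if 0 < Λ ℓ k then edgeLoad R (boughtFrequency R w Λ) ℓ k - c ℓ * f k
  else max 0 (edgeLoad R (boughtFrequency R w Λ) ℓ k - c ℓ * f k)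

/-- `Λ` is a (Carathéodory) solution on `[0, ∞)` of the price updating scheme for bids `w` and
proportions `f`. Since the right-hand side jumps when a price reaches zero, the differential
equation is required at almost every time. The initial prices may be any nonnegative vector. -/
structure IsPriceTrajectory {L P K : Type*} [Fintype L] [Fintype P] (R : K → Matrix L P ℝ)
    (c : L → ℝ) (w : P → K → ℝ) (f : K → ℝ) (Λ : ℝ → L → K → ℝ) : Prop where
  nonneg : ∀ t, 0 ≤ t → ∀ ℓ k, 0 ≤ Λ t ℓ k
  absolutelyContinuous : ∀ T, 0 ≤ T → ∀ ℓ k,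
    AbsolutelyContinuousOnInterval (fun t => Λ t ℓ k) 0 T
  /-- The right-hand side is defined: every operator with a positive bid faces a positive price. -/
  defined : ∀ᵐ t : ℝ, 0 < t → ∀ p k, 0 < w p k → 0 < pathPrice R (Λ t) p k
  hasDerivAt : ∀ᵐ t : ℝ, 0 < t → ∀ ℓ k,
    HasDerivAt (fun s => Λ s ℓ k) (priceVelocity R c w f (Λ t) ℓ k) t

/-- Feasible frequencies for fixed proportions `f`. The condition `pos` says that the objective
`∑ w_{p,k} log x_{p,k}` is finite (with `0 · log 0 = 0`). -/
structure IsFeasible {L P K : Type*} [Fintype P] (R : K → Matrix L P ℝ)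
    (c : L → ℝ) (w : P → K → ℝ) (f : K → ℝ) (x : P → K → ℝ) : Prop where
  nonneg : ∀ p k, 0 ≤ x p k
  pos : ∀ p k, 0 < w p k → 0 < x p k
  capacity : ∀ ℓ k, edgeLoad R x ℓ k ≤ c ℓ * f k

/-- The pseudo-utility `∑_{p,k} w_{p,k} log x_{p,k}`. -/
def pseudoUtility {P K : Type*} [Fintype P] [Fintype K] (w x : P → K → ℝ) : ℝ :=
  ∑ p, ∑ k, w p k * Real.log (x p k)

/-- `x` maximizes the pseudo-utility over the feasible frequencies, for fixed `w` and `f`. -/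
def IsOptimalFrequency {L P K : Type*} [Fintype P] [Fintype K] (R : K → Matrix L P ℝ)
    (c : L → ℝ) (w : P → K → ℝ) (f : K → ℝ) (x : P → K → ℝ) : Prop :=
  IsFeasible R c w f x ∧
    ∀ x', IsFeasible R c w f x' → pseudoUtility w x' ≤ pseudoUtility w x

/-- `Λ` is an optimal price vector for bids `w` and proportions `f`: a vector of Lagrange
multipliers of the capacity constraints at an optimal frequency vector. Stationarity
`w_{p,k} / x_{p,k} = μ_{p,k}(Λ)` is written as a product, so that it also is the
Karush–Kuhn–Tucker condition (for `x_{p,k} ≥ 0`) of a zero bid. -/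
def IsOptimalPrice {L P K : Type*} [Fintype L] [Fintype P] [Fintype K] (R : K → Matrix L P ℝ)
    (c : L → ℝ) (w : P → K → ℝ) (f : K → ℝ) (Λ : L → K → ℝ) : Prop :=
  (∀ ℓ k, 0 ≤ Λ ℓ k) ∧
    ∃ x, IsOptimalFrequency R c w f x ∧
      (∀ p k, pathPrice R Λ p k * x p k = w p k) ∧
      (∀ ℓ k, Λ ℓ k * (edgeLoad R x ℓ k - c ℓ * f k) = 0)

/-- `V(Λ) = ½ ∑_{ℓ,k} (Λ_{ℓ,k} - Λ'_{ℓ,k})²`. -/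
def lyapunov {L K : Type*} [Fintype L] [Fintype K] (Λ' Λ : L → K → ℝ) : ℝ :=
  1 / 2 * ∑ ℓ, ∑ k, (Λ ℓ k - Λ' ℓ k) ^ 2

end

end LinePlanning

/-! Let `V = ½‖Λ - Λ'‖²`, where `Λ'` is optimal with frequencies `x`. Along a trajectory the
derivative of `V` is at most the pairing of `Λ - Λ'` with `y - c f`. Split this at the load of `x`:
complementary slackness of `Λ'` turns one part into minus the slack cost of `x` at prices `Λ`, and
exchanging sums turns the other into `∑ (μ - μ') (w/μ - w/μ')` over positive bids, nonpositive since
demand falls in price. So `V` decreases (`sum_sub_mul_priceVelocity_le`). The loss rate dominates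
`optimalityGap`, which involves the fixed `x` rather than `y`; hence it is continuous even where a
path price vanishes, and its nonnegative zeros are optimal prices. As `V ≥ 0`, the gap gets
arbitrarily small on the bounded trajectory, so some cluster point is optimal. Taking that point as
the new `Λ'`, `V` is monotone and tends to `0` along a sequence, hence `Λ` converges. An optimal
`Λ'` to start from comes from an Eisenberg–Gale type dual problem (`exists_isOptimalPrice`). -/

namespace LinePlanning

open Filter Set MeasureTheory
open scoped Topology

/-! ### Absolutely continuous functions. -/

section Analysis

/-- An absolutely continuous function whose derivative is at most `-ε` almost everywhere decreases
at rate at least `ε`. -/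
lemma le_sub_mul_of_ae_hasDerivAt_le {g : ℝ → ℝ} {a b ε : ℝ} (hab : a ≤ b)
    (hg : AbsolutelyContinuousOnInterval g a b)
    (h : ∀ᵐ t : ℝ, a < t → ∃ g', HasDerivAt g g' t ∧ g' ≤ -ε) :
    g b ≤ g a - ε * (b - a) := by
  have hint := hg.integral_deriv_eq_sub
  have hle : ∫ t in a..b, deriv g t ≤ ∫ _ in a..b, -ε := by
    refine intervalIntegral.integral_mono_ae_restrict hab hg.intervalIntegrable_deriv
      intervalIntegrable_const ?_
    have hae : ∀ᵐ t : ℝ, t ≠ a := by simp [ae_iff, measure_singleton]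
    refine (ae_restrict_iff' measurableSet_Icc).2 ?_
    filter_upwards [h, hae] with t ht hta htI
    obtain ⟨g', hd, hg'⟩ := ht (lt_of_le_of_ne htI.1 (Ne.symm hta))
    rwa [hd.deriv]
  rw [intervalIntegral.integral_const, smul_eq_mul] at hle
  linarith

lemma absolutelyContinuousOnInterval_const (a b r : ℝ) :
    AbsolutelyContinuousOnInterval (fun _ => r) a b :=
  (contDiffOn_const (c := r)).absolutelyContinuousOnInterval

lemma absolutelyContinuousOnInterval_sum {ι : Type*} (s : Finset ι) {g : ι → ℝ → ℝ} {a b : ℝ}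
    (h : ∀ i ∈ s, AbsolutelyContinuousOnInterval (g i) a b) :
    AbsolutelyContinuousOnInterval (fun t => ∑ i ∈ s, g i t) a b := by
  classical
  induction s using Finset.induction_on with
  | empty => simpa using absolutelyContinuousOnInterval_const a b 0
  | insert i s hi ih =>
    simp only [Finset.sum_insert hi]
    exact (h i (Finset.mem_insert_self i s)).add
      (ih fun j hj => h j (Finset.mem_insert_of_mem hj))

end Analysis

variable {L P K : Type*} [Fintype L] [Fintype P] [Fintype K]

/-! ### Payments and path prices. -/

section Algebra

/-- Total payments computed edgewise and linewise agree. -/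
lemma sum_mul_edgeLoad (R : K → Matrix L P ℝ) (Λ : L → K → ℝ) (x : P → K → ℝ) :
    ∑ ℓ, ∑ k, Λ ℓ k * edgeLoad R x ℓ k = ∑ p, ∑ k, pathPrice R Λ p k * x p k := by
  simp only [edgeLoad, pathPrice, Finset.mul_sum, Finset.sum_mul]
  rw [Finset.sum_comm, Finset.sum_comm (s := (Finset.univ : Finset P))]
  refine Finset.sum_congr rfl fun k _ => ?_
  rw [Finset.sum_comm]
  exact Finset.sum_congr rfl fun p _ => Finset.sum_congr rfl fun ℓ _ => by ring

omit [Fintype P] [Fintype K] in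
lemma pathPrice_nonneg {R : K → Matrix L P ℝ} (hR : ∀ k ℓ p, 0 ≤ R k ℓ p) {Λ : L → K → ℝ}
    (hΛ : ∀ ℓ k, 0 ≤ Λ ℓ k) (p : P) (k : K) : 0 ≤ pathPrice R Λ p k :=
  Finset.sum_nonneg fun ℓ _ => mul_nonneg (hΛ ℓ k) (hR k ℓ p)

omit [Fintype P] [Fintype K] in
lemma continuous_pathPrice (R : K → Matrix L P ℝ) (p : P) (k : K) :
    Continuous fun Λ : L → K → ℝ => pathPrice R Λ p k := by
  unfold pathPrice
  fun_prop

omit [Fintype P] [Fintype K] in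
lemma pathPrice_add_smul (R : K → Matrix L P ℝ) (Λ Λ' : L → K → ℝ) (s : ℝ) (p : P) (k : K) :
    pathPrice R (Λ + s • Λ') p k = pathPrice R Λ p k + s * pathPrice R Λ' p k := by
  simp only [pathPrice, Pi.add_apply, Pi.smul_apply, smul_eq_mul, Finset.mul_sum]
  rw [← Finset.sum_add_distrib]
  exact Finset.sum_congr rfl fun ℓ _ => by ring

omit [Fintype P] [Fintype K] in
lemma pathPrice_mul_boughtFrequency {R : K → Matrix L P ℝ} {w : P → K → ℝ} {Λ : L → K → ℝ}
    {p : P} {k : K} (hw : 0 ≤ w p k) (hpos : 0 < w p k → 0 < pathPrice R Λ p k) :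
    pathPrice R Λ p k * boughtFrequency R w Λ p k = w p k := by
  unfold boughtFrequency
  rcases hw.eq_or_lt with h | h
  · simp [← h]
  · exact mul_div_cancel₀ _ (hpos h).ne'

end Algebra

/-! ### Existence of optimal prices by duality. -/

section Existence

/-- Karush–Kuhn–Tucker conditions are sufficient: prices supporting their own demand are
optimal. -/
lemma isOptimalPrice_of_edgeLoad_le {R : K → Matrix L P ℝ} (hR : ∀ k ℓ p, 0 ≤ R k ℓ p)
    {c : L → ℝ} {w : P → K → ℝ} (hw : ∀ p k, 0 ≤ w p k) {f : K → ℝ} {Λ : L → K → ℝ}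
    (hΛ : ∀ ℓ k, 0 ≤ Λ ℓ k) (hpos : ∀ p k, 0 < w p k → 0 < pathPrice R Λ p k)
    (hcap : ∀ ℓ k, edgeLoad R (boughtFrequency R w Λ) ℓ k ≤ c ℓ * f k)
    (hcs : ∀ ℓ k, Λ ℓ k * (edgeLoad R (boughtFrequency R w Λ) ℓ k - c ℓ * f k) = 0) :
    IsOptimalPrice R c w f Λ := by
  have hstat : ∀ p k, pathPrice R Λ p k * boughtFrequency R w Λ p k = w p k :=
    fun p k => pathPrice_mul_boughtFrequency (hw p k) (hpos p k)
  refine ⟨hΛ, boughtFrequency R w Λ, ⟨⟨fun p k => ?_, fun p k h => ?_, hcap⟩, ?_⟩, hstat, hcs⟩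
  · exact div_nonneg (hw p k) (pathPrice_nonneg hR hΛ p k)
  · exact div_pos h (hpos p k h)
  intro x' hx'
  -- Tangent line of the concave `w log` at the bought frequency, where the slope is `w / x = μ`.
  have hterm : ∀ p k, w p k * Real.log (x' p k) ≤
      w p k * Real.log (boughtFrequency R w Λ p k) + (pathPrice R Λ p k * x' p k - w p k) := by
    intro p k
    have hx0 := hx'.nonneg p k
    rcases (hw p k).eq_or_lt with h | h
    · have := mul_nonneg (pathPrice_nonneg hR hΛ p k) hx0
      simpa [← h] using this
    · have hμ := hpos p k h
      have hx1 := hx'.pos p k h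
      have hx : 0 < boughtFrequency R w Λ p k := div_pos h hμ
      have hlog := Real.log_le_sub_one_of_pos (div_pos hx1 hx)
      rw [Real.log_div hx1.ne' hx.ne'] at hlog
      have hmul := mul_le_mul_of_nonneg_left hlog h.le
      have heq : w p k * (x' p k / boughtFrequency R w Λ p k - 1) =
          pathPrice R Λ p k * x' p k - w p k := by
        unfold boughtFrequency
        field_simp
      rw [heq] at hmul
      linarith
  have hsum : pseudoUtility w x' ≤ pseudoUtility w (boughtFrequency R w Λ) +
      (∑ p, ∑ k, pathPrice R Λ p k * x' p k - ∑ p, ∑ k, w p k) := by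
    unfold pseudoUtility
    simp only [← Finset.sum_add_distrib, ← Finset.sum_sub_distrib]
    exact Finset.sum_le_sum fun p _ => Finset.sum_le_sum fun k _ => hterm p k
  have hbudget : ∑ p, ∑ k, pathPrice R Λ p k * x' p k ≤ ∑ p, ∑ k, w p k := by
    simp only [← hstat]
    rw [← sum_mul_edgeLoad, ← sum_mul_edgeLoad]
    refine Finset.sum_le_sum fun ℓ _ => Finset.sum_le_sum fun k _ => ?_
    have h1 := mul_le_mul_of_nonneg_left (hx'.capacity ℓ k) (hΛ ℓ k)
    have h2 := hcs ℓ k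
    linarith
  linarith

/-- First-order condition for a maximizer of `∑ w log μ` on a segment. -/
lemma sum_mul_div_le_of_forall_prod_rpow_le {ι : Type*} [Fintype ι] {w μ μ' : ι → ℝ}
    (hw : ∀ i, 0 ≤ w i) (hμ : ∀ i, 0 < w i → 0 < μ i) (hμ' : ∀ i, 0 ≤ μ' i)
    (hmax : ∀ s ∈ Icc (0 : ℝ) 1,
      ∏ i, (μ i + s * (μ' i - μ i)) ^ w i ≤ ∏ i, μ i ^ w i) :
    ∑ i, w i * ((μ' i - μ i) / μ i) ≤ 0 := by
  set F : ℝ → ℝ := fun s => ∑ i, w i * Real.log (μ i + s * (μ' i - μ i)) with hF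
  -- `s = 1` is left out because `μ'` may vanish.
  have hpos : ∀ s ∈ Ico (0 : ℝ) 1, ∀ i, 0 < w i → 0 < μ i + s * (μ' i - μ i) := by
    intro s hs i hi
    have h1 : 0 < (1 - s) * μ i := mul_pos (by linarith [hs.2]) (hμ i hi)
    have h2 : 0 ≤ s * μ' i := mul_nonneg hs.1 (hμ' i)
    linarith
  have hlog : ∀ ν : ι → ℝ, (∀ i, 0 < w i → 0 < ν i) →
      0 < ∏ i, ν i ^ w i ∧ Real.log (∏ i, ν i ^ w i) = ∑ i, w i * Real.log (ν i) := by
    intro ν hν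
    have hp : ∀ i, 0 < ν i ^ w i := fun i => by
      rcases (hw i).eq_or_lt with h | h
      · simp [← h]
      · exact Real.rpow_pos_of_pos (hν i h) _
    refine ⟨Finset.prod_pos fun i _ => hp i, ?_⟩
    rw [Real.log_prod fun i _ => (hp i).ne']
    refine Finset.sum_congr rfl fun i _ => ?_
    rcases (hw i).eq_or_lt with h | h
    · simp [← h]
    · exact Real.log_rpow (hν i h) _
  have hder : HasDerivAt F (∑ i, w i * ((μ' i - μ i) / μ i)) 0 := by
    refine HasDerivAt.fun_sum fun i _ => ?_
    rcases (hw i).eq_or_lt with h | h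
    · simpa [← h] using hasDerivAt_const (0 : ℝ) (0 : ℝ)
    · have hlin : HasDerivAt (fun s : ℝ => μ i + s * (μ' i - μ i)) (μ' i - μ i) 0 := by
        simpa using ((hasDerivAt_id (0 : ℝ)).mul_const (μ' i - μ i)).const_add (μ i)
      have hl := (hlin.log (by simpa using (hμ i h).ne')).const_mul (w i)
      simpa using hl
  have hloc : IsLocalMaxOn F (Icc 0 1) 0 := by
    have hnear : ∀ᶠ s in 𝓝[Icc (0 : ℝ) 1] 0, s < 1 :=
      nhdsWithin_le_nhds (Iio_mem_nhds zero_lt_one)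
    filter_upwards [hnear, self_mem_nhdsWithin] with s hs1 hs
    obtain ⟨h1, h2⟩ := hlog _ (hpos s ⟨hs.1, hs1⟩)
    obtain ⟨-, h4⟩ := hlog _ hμ
    have h := Real.log_le_log h1 (hmax s hs)
    rw [h2, h4] at h
    simpa [hF] using h
  have hcone : (1 : ℝ) ∈ posTangentConeAt (Icc (0 : ℝ) 1) 0 := by
    apply mem_posTangentConeAt_of_segment_subset
    simp [segment_eq_Icc]
  simpa using hloc.hasFDerivWithinAt_nonpos hder.hasFDerivAt.hasFDerivWithinAt hcone

/-- Optimal prices exist if every positive bid can be charged a positive price. They are found by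
maximizing `∏ μ ^ w` over the prices at which the capacities cost at most the sum of the bids. -/
lemma exists_isOptimalPrice {R : K → Matrix L P ℝ} (hR : ∀ k ℓ p, 0 ≤ R k ℓ p)
    {c : L → ℝ} (hc : ∀ ℓ, 0 < c ℓ) {w : P → K → ℝ} (hw : ∀ p k, 0 ≤ w p k)
    {f : K → ℝ} (hf : ∀ k, 0 < f k) {Λ₀ : L → K → ℝ} (hΛ₀ : ∀ ℓ k, 0 ≤ Λ₀ ℓ k)
    (hpos₀ : ∀ p k, 0 < w p k → 0 < pathPrice R Λ₀ p k) :
    ∃ Λ, IsOptimalPrice R c w f Λ := by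
  classical
  have hcf : ∀ ℓ k, 0 < c ℓ * f k := fun ℓ k => mul_pos (hc ℓ) (hf k)
  set W : ℝ := ∑ p, ∑ k, w p k with hW
  have hW0 : 0 ≤ W := Finset.sum_nonneg fun p _ => Finset.sum_nonneg fun k _ => hw p k
  rcases hW0.eq_or_lt with hWz | hWpos
  · have hwz : ∀ p k, w p k = 0 := by
      intro p k
      have h1 := (Finset.sum_eq_zero_iff_of_nonneg
        fun p _ => Finset.sum_nonneg fun k _ => hw p k).1 hWz.symm p (Finset.mem_univ p)
      exact (Finset.sum_eq_zero_iff_of_nonneg fun k _ => hw p k).1 h1 k (Finset.mem_univ k)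
    refine ⟨0, isOptimalPrice_of_edgeLoad_le hR hw (fun _ _ => le_rfl) (fun p k h => ?_)
      (fun ℓ k => ?_) fun ℓ k => ?_⟩
    · exact absurd (hwz p k) h.ne'
    · simpa [edgeLoad, boughtFrequency, hwz] using (hcf ℓ k).le
    · simp
  set cost : (L → K → ℝ) → ℝ := fun Λ => ∑ ℓ, ∑ k, Λ ℓ k * (c ℓ * f k) with hcost
  set S : Set (L → K → ℝ) := {Λ | (∀ ℓ k, 0 ≤ Λ ℓ k) ∧ cost Λ ≤ W} with hS
  have hterm_le : ∀ Λ : L → K → ℝ, (∀ ℓ k, 0 ≤ Λ ℓ k) → ∀ ℓ k,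
      Λ ℓ k * (c ℓ * f k) ≤ cost Λ := by
    intro Λ hΛ ℓ k
    have hnn : ∀ ℓ k, 0 ≤ Λ ℓ k * (c ℓ * f k) := fun ℓ k => mul_nonneg (hΛ ℓ k) (hcf ℓ k).le
    exact (Finset.single_le_sum (fun k _ => hnn ℓ k) (Finset.mem_univ k)).trans
      (Finset.single_le_sum (f := fun ℓ => ∑ k, Λ ℓ k * (c ℓ * f k))
        (fun ℓ _ => Finset.sum_nonneg fun k _ => hnn ℓ k) (Finset.mem_univ ℓ))
  have hcost_cont : Continuous cost := by
    simp only [hcost]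
    fun_prop
  have hcomp : IsCompact S := by
    have hbox : IsCompact (Icc (0 : L → K → ℝ) fun ℓ k => W / (c ℓ * f k)) := isCompact_Icc
    refine hbox.of_isClosed_subset ?_ ?_
    · have hnn : IsClosed {Λ : L → K → ℝ | 0 ≤ Λ} := isClosed_le continuous_const continuous_id
      exact hnn.inter (isClosed_le hcost_cont continuous_const)
    · rintro Λ ⟨h1, h2⟩
      refine ⟨fun ℓ k => h1 ℓ k, fun ℓ k => ?_⟩
      rw [le_div_iff₀ (hcf ℓ k)]
      exact (hterm_le Λ h1 ℓ k).trans h2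
  -- The product, unlike the sum of logarithms, stays continuous where a path price vanishes.
  set Φ : (L → K → ℝ) → ℝ := fun Λ => ∏ i : P × K, pathPrice R Λ i.1 i.2 ^ w i.1 i.2 with hΦ
  have hΦ_cont : Continuous Φ := by
    refine continuous_finsetProd _ fun i _ => ?_
    exact (continuous_pathPrice R i.1 i.2).rpow_const fun _ => Or.inr (hw _ _)
  obtain ⟨Λ, ⟨hΛ, hΛW⟩, hmax⟩ := hcomp.exists_isMaxOn
    ⟨0, fun _ _ => le_rfl, by simpa [hcost] using hW0⟩ hΦ_cont.continuousOn
  have hmax' : ∀ Λ' ∈ S, Φ Λ' ≤ Φ Λ := fun Λ' h => hmax h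
  have hcost₀ : 0 ≤ cost Λ₀ := Finset.sum_nonneg fun ℓ _ => Finset.sum_nonneg fun k _ =>
    mul_nonneg (hΛ₀ ℓ k) (hcf ℓ k).le
  have hΦpos : 0 < Φ Λ := by
    -- Rescaling makes `Λ₀` affordable; the `+ 1` covers `cost Λ₀ = 0`.
    set s : ℝ := W / (cost Λ₀ + 1) with hs
    have hs0 : 0 < s := div_pos hWpos (by linarith)
    have hmem : (0 : L → K → ℝ) + s • Λ₀ ∈ S := by
      refine ⟨fun ℓ k => by simpa using mul_nonneg hs0.le (hΛ₀ ℓ k), ?_⟩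
      have hscale : cost ((0 : L → K → ℝ) + s • Λ₀) = s * cost Λ₀ := by
        simp only [hcost, zero_add, Pi.smul_apply, smul_eq_mul, Finset.mul_sum, mul_assoc]
      rw [hscale, hs, div_mul_eq_mul_div, div_le_iff₀ (by linarith)]
      nlinarith
    refine lt_of_lt_of_le ?_ (hmax' _ hmem)
    refine Finset.prod_pos fun i _ => ?_
    rw [pathPrice_add_smul]
    rcases (hw i.1 i.2).eq_or_lt with h | h
    · simp [← h]
    · refine Real.rpow_pos_of_pos ?_ _
      simpa [pathPrice] using mul_pos hs0 (hpos₀ _ _ h)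
  have hpos : ∀ p k, 0 < w p k → 0 < pathPrice R Λ p k := by
    intro p k h
    refine (pathPrice_nonneg hR hΛ p k).lt_of_ne fun h0 => hΦpos.ne' ?_
    refine Finset.prod_eq_zero (Finset.mem_univ (p, k)) ?_
    simp only [← h0]
    exact Real.zero_rpow h.ne'
  have hpay : ∑ ℓ, ∑ k, Λ ℓ k * edgeLoad R (boughtFrequency R w Λ) ℓ k = W := by
    rw [sum_mul_edgeLoad]
    exact Finset.sum_congr rfl fun p _ => Finset.sum_congr rfl fun k _ =>
      pathPrice_mul_boughtFrequency (hw p k) (hpos p k)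
  have hfoc : ∀ Λ' ∈ S,
      ∑ ℓ, ∑ k, Λ' ℓ k * edgeLoad R (boughtFrequency R w Λ) ℓ k ≤ W := by
    rintro Λ' ⟨hΛ', hΛ'W⟩
    have h := sum_mul_div_le_of_forall_prod_rpow_le (ι := P × K)
      (w := fun i => w i.1 i.2) (μ := fun i => pathPrice R Λ i.1 i.2)
      (μ' := fun i => pathPrice R Λ' i.1 i.2) (fun i => hw _ _) (fun i => hpos _ _)
      (fun i => pathPrice_nonneg hR hΛ' _ _) (by
        intro s hs
        have hmem : (Λ + s • (Λ' + (-1 : ℝ) • Λ)) ∈ S := by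
          refine ⟨fun ℓ k => ?_, ?_⟩
          · have h1 := mul_nonneg (sub_nonneg.2 hs.2) (hΛ ℓ k)
            have h2 := mul_nonneg hs.1 (hΛ' ℓ k)
            simp only [Pi.add_apply, Pi.smul_apply, smul_eq_mul]
            linarith
          · have hlin : cost (Λ + s • (Λ' + (-1 : ℝ) • Λ)) =
                (1 - s) * cost Λ + s * cost Λ' := by
              simp only [hcost, Pi.add_apply, Pi.smul_apply, smul_eq_mul, Finset.mul_sum,
                ← Finset.sum_add_distrib]
              exact Finset.sum_congr rfl fun ℓ _ => Finset.sum_congr rfl fun k _ => by ring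
            rw [hlin]
            nlinarith [mul_le_mul_of_nonneg_left hΛW (sub_nonneg.2 hs.2),
              mul_le_mul_of_nonneg_left hΛ'W hs.1]
        have hle := hmax' _ hmem
        simp only [hΦ, pathPrice_add_smul] at hle
        convert hle using 4
        ring)
    have hrew : ∑ i : P × K, w i.1 i.2 *
        ((pathPrice R Λ' i.1 i.2 - pathPrice R Λ i.1 i.2) / pathPrice R Λ i.1 i.2) =
        ∑ p, ∑ k, pathPrice R Λ' p k * boughtFrequency R w Λ p k -
          ∑ p, ∑ k, pathPrice R Λ p k * boughtFrequency R w Λ p k := by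
      rw [Fintype.sum_prod_type]
      simp only [← Finset.sum_sub_distrib]
      refine Finset.sum_congr rfl fun p _ => Finset.sum_congr rfl fun k _ => ?_
      unfold boughtFrequency
      ring
    rw [hrew, ← sum_mul_edgeLoad, ← sum_mul_edgeLoad, hpay] at h
    linarith
  have hcap : ∀ ℓ k, edgeLoad R (boughtFrequency R w Λ) ℓ k ≤ c ℓ * f k := by
    intro ℓ k
    -- Test prices spending the whole budget `W` on the single pair `(ℓ, k)`: `hfoc` then bounds the
    -- load there.
    have hsingle : ∀ g : L → K → ℝ,
        ∑ ℓ', ∑ k', (if ℓ' = ℓ ∧ k' = k then W / (c ℓ * f k) else 0) * g ℓ' k' =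
          W / (c ℓ * f k) * g ℓ k := by
      intro g
      rw [Finset.sum_eq_single ℓ (fun ℓ' _ h => by simp [h]) (by simp),
        Finset.sum_eq_single k (fun k' _ h => by simp [h]) (by simp)]
      simp
    have hmem : (fun ℓ' k' => if ℓ' = ℓ ∧ k' = k then W / (c ℓ * f k) else 0) ∈ S := by
      refine ⟨fun ℓ' k' => ?_, ?_⟩
      · dsimp only
        split_ifs
        exacts [div_nonneg hW0 (hcf ℓ k).le, le_rfl]
      · refine ((hsingle fun ℓ k => c ℓ * f k).trans ?_).le
        exact div_mul_cancel₀ _ (hcf ℓ k).ne'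
    have h := hfoc _ hmem
    rw [hsingle, div_mul_eq_mul_div, div_le_iff₀ (hcf ℓ k)] at h
    exact le_of_mul_le_mul_left h hWpos
  have hslack : ∀ ℓ k, 0 ≤ Λ ℓ k * (c ℓ * f k - edgeLoad R (boughtFrequency R w Λ) ℓ k) :=
    fun ℓ k => mul_nonneg (hΛ ℓ k) (sub_nonneg.2 (hcap ℓ k))
  -- The sum is `cost Λ - W ≤ 0` with nonnegative terms, so each term vanishes.
  have hslack_sum :
      ∑ ℓ, ∑ k, Λ ℓ k * (c ℓ * f k - edgeLoad R (boughtFrequency R w Λ) ℓ k) = 0 := by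
    refine le_antisymm ?_ (Finset.sum_nonneg fun ℓ _ => Finset.sum_nonneg fun k _ => hslack ℓ k)
    simp only [mul_sub, Finset.sum_sub_distrib]
    rw [hpay]
    exact sub_nonpos.2 hΛW
  refine ⟨Λ, isOptimalPrice_of_edgeLoad_le hR hw hΛ hpos hcap fun ℓ k => ?_⟩
  have h1 := (Finset.sum_eq_zero_iff_of_nonneg
    fun ℓ _ => Finset.sum_nonneg fun k _ => hslack ℓ k).1 hslack_sum ℓ (Finset.mem_univ ℓ)
  have h2 := (Finset.sum_eq_zero_iff_of_nonneg fun k _ => hslack ℓ k).1 h1 k (Finset.mem_univ k)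
  linarith

end Existence

/-! ### Decay rate of the distance to optimal prices. -/

section Dissipation

/-- Defect of the Karush–Kuhn–Tucker conditions of the prices `Λ` with the frequencies `x`, the
stationarity part being scaled by `B`. -/
noncomputable def optimalityGap (R : K → Matrix L P ℝ) (c : L → ℝ) (w : P → K → ℝ) (f : K → ℝ)
    (x : P → K → ℝ) (B : ℝ) (Λ : L → K → ℝ) : ℝ :=
  ∑ p, ∑ k, (pathPrice R Λ p k * x p k - w p k) ^ 2 / B +
    ∑ ℓ, ∑ k, Λ ℓ k * (c ℓ * f k - edgeLoad R x ℓ k)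

lemma continuous_optimalityGap (R : K → Matrix L P ℝ) (c : L → ℝ) (w : P → K → ℝ) (f : K → ℝ)
    (x : P → K → ℝ) (B : ℝ) : Continuous (optimalityGap R c w f x B) := by
  unfold optimalityGap pathPrice
  fun_prop

lemma optimalityGap_nonneg {R : K → Matrix L P ℝ} {c : L → ℝ} {w : P → K → ℝ} {f : K → ℝ}
    {x : P → K → ℝ} (hx : IsFeasible R c w f x) {B : ℝ} (hB : 0 < B) {Λ : L → K → ℝ}
    (hΛ : ∀ ℓ k, 0 ≤ Λ ℓ k) : 0 ≤ optimalityGap R c w f x B Λ :=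
  add_nonneg (Finset.sum_nonneg fun p _ => Finset.sum_nonneg fun k _ => by positivity)
    (Finset.sum_nonneg fun ℓ _ => Finset.sum_nonneg fun k _ =>
      mul_nonneg (hΛ ℓ k) (sub_nonneg.2 (hx.capacity ℓ k)))

/-- Prices whose gap at an optimal frequency vector vanishes are optimal. -/
lemma isOptimalPrice_of_optimalityGap_nonpos {R : K → Matrix L P ℝ} {c : L → ℝ} {w : P → K → ℝ}
    {f : K → ℝ} {x : P → K → ℝ} (hx : IsOptimalFrequency R c w f x) {B : ℝ} (hB : 0 < B)
    {Λ : L → K → ℝ} (hΛ : ∀ ℓ k, 0 ≤ Λ ℓ k) (h : optimalityGap R c w f x B Λ ≤ 0) :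
    IsOptimalPrice R c w f Λ := by
  have hsq : ∀ p k, 0 ≤ (pathPrice R Λ p k * x p k - w p k) ^ 2 / B := fun p k => by positivity
  have hsl : ∀ ℓ k, 0 ≤ Λ ℓ k * (c ℓ * f k - edgeLoad R x ℓ k) := fun ℓ k =>
    mul_nonneg (hΛ ℓ k) (sub_nonneg.2 (hx.1.capacity ℓ k))
  have hsq' := fun p (_ : p ∈ Finset.univ) => Finset.sum_nonneg
    fun k (_ : k ∈ Finset.univ) => hsq p k
  have hsl' := fun ℓ (_ : ℓ ∈ Finset.univ) => Finset.sum_nonneg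
    fun k (_ : k ∈ Finset.univ) => hsl ℓ k
  have h1 := Finset.sum_nonneg hsq'
  have h2 := Finset.sum_nonneg hsl'
  unfold optimalityGap at h
  have h1' := (Finset.sum_eq_zero_iff_of_nonneg hsq').1 (by linarith)
  have h2' := (Finset.sum_eq_zero_iff_of_nonneg hsl').1 (by linarith)
  refine ⟨hΛ, x, hx, fun p k => ?_, fun ℓ k => ?_⟩
  · have h3 := (Finset.sum_eq_zero_iff_of_nonneg fun k _ => hsq p k).1
      (h1' p (Finset.mem_univ p)) k (Finset.mem_univ k)
    rcases div_eq_zero_iff.1 h3 with h4 | h4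
    · exact sub_eq_zero.1 (pow_eq_zero_iff two_ne_zero |>.1 h4)
    · exact absurd h4 hB.ne'
  · have h3 := (Finset.sum_eq_zero_iff_of_nonneg fun k _ => hsl ℓ k).1
      (h2' ℓ (Finset.mem_univ ℓ)) k (Finset.mem_univ k)
    linarith

/-- Quantitative monotonicity of the demand `μ ↦ w / μ`. -/
lemma sq_div_le_mul_sub_div {w μ μ' x B : ℝ} (hw : 0 ≤ w) (hμ : 0 ≤ μ) (hx : 0 ≤ x)
    (hstat : μ' * x = w) (hpos : 0 < w → 0 < μ) (hB : 0 < B) (hle : μ * x ≤ B) :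
    (μ * x - w) ^ 2 / B ≤ (μ - μ') * (x - w / μ) := by
  have hμx : 0 ≤ μ * x := mul_nonneg hμ hx
  rcases hw.eq_or_lt with h | h
  -- For a zero bid `w / μ = 0` even at `μ = 0`, and `μ' * x = 0`; then `μ * x ≤ B` suffices.
  · have heq : (μ - μ') * (x - w / μ) = μ * x := by
      rw [← h, zero_div, sub_zero, sub_mul, hstat, ← h, sub_zero]
    rw [heq, div_le_iff₀ hB, ← h, sub_zero, pow_two]
    exact mul_le_mul_of_nonneg_left hle hμx
  · have hμ0 := hpos h
    have hx0 : 0 < x := hx.lt_of_ne fun h0 => by simp [← h0] at hstat; linarith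
    have heq : (μ - μ') * (x - w / μ) = (μ * x - w) ^ 2 / (μ * x) := by
      rw [← hstat]
      field_simp
    rw [heq]
    exact div_le_div_of_nonneg_left (sq_nonneg _) (mul_pos hμ0 hx0) hle

lemma sum_sub_mul_priceVelocity_le {R : K → Matrix L P ℝ} (hR : ∀ k ℓ p, 0 ≤ R k ℓ p)
    {c : L → ℝ} {w : P → K → ℝ} (hw : ∀ p k, 0 ≤ w p k) {f : K → ℝ} {Λ Λ' : L → K → ℝ}
    {x : P → K → ℝ} (hx : IsFeasible R c w f x) (hΛ' : ∀ ℓ k, 0 ≤ Λ' ℓ k)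
    (hstat : ∀ p k, pathPrice R Λ' p k * x p k = w p k)
    (hcs : ∀ ℓ k, Λ' ℓ k * (edgeLoad R x ℓ k - c ℓ * f k) = 0)
    (hΛ : ∀ ℓ k, 0 ≤ Λ ℓ k) (hpos : ∀ p k, 0 < w p k → 0 < pathPrice R Λ p k)
    {B : ℝ} (hB : 0 < B) (hle : ∀ p k, pathPrice R Λ p k * x p k ≤ B) :
    ∑ ℓ, ∑ k, (Λ ℓ k - Λ' ℓ k) * priceVelocity R c w f Λ ℓ k ≤
      -optimalityGap R c w f x B Λ := by
  set y := boughtFrequency R w Λ with hy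
  -- Expanded into four payments, so that `sum_mul_edgeLoad` applies to each after summation.
  have hvel : ∀ ℓ k, (Λ ℓ k - Λ' ℓ k) * priceVelocity R c w f Λ ℓ k ≤
      Λ ℓ k * edgeLoad R y ℓ k - Λ' ℓ k * edgeLoad R y ℓ k - Λ ℓ k * edgeLoad R x ℓ k +
        Λ' ℓ k * edgeLoad R x ℓ k - Λ ℓ k * (c ℓ * f k - edgeLoad R x ℓ k) := by
    intro ℓ k
    have h := hcs ℓ k
    suffices (Λ ℓ k - Λ' ℓ k) * priceVelocity R c w f Λ ℓ k ≤
        (Λ ℓ k - Λ' ℓ k) * (edgeLoad R y ℓ k - c ℓ * f k) by linarith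
    unfold priceVelocity
    split_ifs with h0
    · exact le_rfl
    -- Here `Λ - Λ' = -Λ' ≤ 0`, so raising the velocity to `max 0 _` can only lower the product.
    · have hz : Λ ℓ k = 0 := le_antisymm (not_lt.1 h0) (hΛ ℓ k)
      rw [hz]
      have := mul_le_mul_of_nonneg_left
        (le_max_right 0 (edgeLoad R y ℓ k - c ℓ * f k)) (hΛ' ℓ k)
      linarith
  have hdem : ∑ p, ∑ k, (pathPrice R Λ p k * x p k - w p k) ^ 2 / B ≤
      ∑ p, ∑ k, (pathPrice R Λ p k * x p k - pathPrice R Λ' p k * x p k -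
        pathPrice R Λ p k * y p k + pathPrice R Λ' p k * y p k) := by
    refine Finset.sum_le_sum fun p _ => Finset.sum_le_sum fun k _ => ?_
    refine (sq_div_le_mul_sub_div (hw p k) (pathPrice_nonneg hR hΛ p k) (hx.nonneg p k)
      (hstat p k) (hpos p k) hB (hle p k)).trans_eq ?_
    simp only [hy, boughtFrequency]
    ring
  have hsum := Finset.sum_le_sum fun ℓ (_ : ℓ ∈ Finset.univ) =>
    Finset.sum_le_sum fun k (_ : k ∈ Finset.univ) => hvel ℓ k
  simp only [Finset.sum_add_distrib, Finset.sum_sub_distrib] at hsum hdem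
  rw [sum_mul_edgeLoad, sum_mul_edgeLoad, sum_mul_edgeLoad, sum_mul_edgeLoad] at hsum
  unfold optimalityGap
  linarith

end Dissipation

/-! ### Monotonicity and convergence along a trajectory. -/

section Trajectory

lemma continuous_lyapunov (Λ' : L → K → ℝ) :
    Continuous (lyapunov Λ') := by
  unfold lyapunov
  fun_prop

lemma lyapunov_nonneg (Λ' Λ : L → K → ℝ) : 0 ≤ lyapunov Λ' Λ := by
  unfold lyapunov
  positivity

lemma sq_le_two_mul_lyapunov (Λ' Λ : L → K → ℝ) (ℓ : L) (k : K) :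
    (Λ ℓ k - Λ' ℓ k) ^ 2 ≤ 2 * lyapunov Λ' Λ := by
  have h1 := Finset.single_le_sum (f := fun k => (Λ ℓ k - Λ' ℓ k) ^ 2)
    (fun k _ => sq_nonneg _) (Finset.mem_univ k)
  have h2 := Finset.single_le_sum (f := fun ℓ => ∑ k, (Λ ℓ k - Λ' ℓ k) ^ 2)
    (fun ℓ _ => Finset.sum_nonneg fun k _ => sq_nonneg _) (Finset.mem_univ ℓ)
  unfold lyapunov
  linarith

/-- Passes from the Euclidean norm in `lyapunov` to the sup metric of the function space. -/
lemma dist_le_sqrt_lyapunov (Λ' Λ : L → K → ℝ) : dist Λ Λ' ≤ √(2 * lyapunov Λ' Λ) := by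
  refine (dist_pi_le_iff (Real.sqrt_nonneg _)).2 fun ℓ =>
    (dist_pi_le_iff (Real.sqrt_nonneg _)).2 fun k => ?_
  rw [Real.dist_eq]
  exact Real.abs_le_sqrt (sq_le_two_mul_lyapunov Λ' Λ ℓ k)

variable {R : K → Matrix L P ℝ} {c : L → ℝ} {w : P → K → ℝ} {f : K → ℝ} {Λ : ℝ → L → K → ℝ}

lemma IsPriceTrajectory.absolutelyContinuous_lyapunov (hΛ : IsPriceTrajectory R c w f Λ)
    (Λ' : L → K → ℝ) {a b : ℝ} (ha : 0 ≤ a) (hab : a ≤ b) :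
    AbsolutelyContinuousOnInterval (fun t => lyapunov Λ' (Λ t)) a b := by
  have hcoord : ∀ ℓ k, AbsolutelyContinuousOnInterval (fun t => (Λ t ℓ k - Λ' ℓ k) ^ 2) a b := by
    intro ℓ k
    have h0 := (hΛ.absolutelyContinuous b (ha.trans hab) ℓ k).mono (c := a) (d := b) (by
      rw [uIcc_of_le hab, uIcc_of_le (ha.trans hab)]
      exact Icc_subset_Icc_left ha)
    have h1 := h0.sub (absolutelyContinuousOnInterval_const a b (Λ' ℓ k))
    simpa [pow_two] using h1.fun_mul h1
  exact (absolutelyContinuousOnInterval_sum _ fun ℓ _ =>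
    absolutelyContinuousOnInterval_sum _ fun k _ => hcoord ℓ k).const_mul (1 / 2)

/-- Almost everywhere, the distance to optimal prices decreases at least at the rate of the gap. -/
lemma IsPriceTrajectory.ae_hasDerivAt_lyapunov (hΛ : IsPriceTrajectory R c w f Λ)
    (hR : ∀ k ℓ p, 0 ≤ R k ℓ p) (hw : ∀ p k, 0 ≤ w p k) {Λ' : L → K → ℝ} {x : P → K → ℝ}
    (hx : IsFeasible R c w f x) (hΛ' : ∀ ℓ k, 0 ≤ Λ' ℓ k)
    (hstat : ∀ p k, pathPrice R Λ' p k * x p k = w p k)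
    (hcs : ∀ ℓ k, Λ' ℓ k * (edgeLoad R x ℓ k - c ℓ * f k) = 0) :
    ∀ᵐ t : ℝ, 0 < t → ∃ v, HasDerivAt (fun s => lyapunov Λ' (Λ s)) v t ∧
      ∀ B, 0 < B → (∀ p k, pathPrice R (Λ t) p k * x p k ≤ B) →
        v ≤ -optimalityGap R c w f x B (Λ t) := by
  filter_upwards [hΛ.defined, hΛ.hasDerivAt] with t hdef hder ht
  refine ⟨∑ ℓ, ∑ k, (Λ t ℓ k - Λ' ℓ k) * priceVelocity R c w f (Λ t) ℓ k, ?_,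
    fun B hB hle => sum_sub_mul_priceVelocity_le hR hw hx hΛ' hstat hcs
      (hΛ.nonneg t ht.le) (hdef ht) hB hle⟩
  have h : HasDerivAt (fun s => 1 / 2 * ∑ ℓ, ∑ k, (Λ s ℓ k - Λ' ℓ k) ^ 2)
      (1 / 2 * ∑ ℓ, ∑ k, 2 * (Λ t ℓ k - Λ' ℓ k) * priceVelocity R c w f (Λ t) ℓ k) t := by
    refine HasDerivAt.const_mul _ (HasDerivAt.fun_sum fun ℓ _ => HasDerivAt.fun_sum fun k _ => ?_)
    simpa using ((hder ht ℓ k).sub_const (Λ' ℓ k)).fun_pow 2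
  refine h.congr_deriv ?_
  simp only [Finset.mul_sum]
  exact Finset.sum_congr rfl fun ℓ _ => Finset.sum_congr rfl fun k _ => by ring

lemma IsPriceTrajectory.antitoneOn_lyapunov (hΛ : IsPriceTrajectory R c w f Λ)
    (hR : ∀ k ℓ p, 0 ≤ R k ℓ p) (hw : ∀ p k, 0 ≤ w p k) {Λ' : L → K → ℝ}
    (hΛ' : IsOptimalPrice R c w f Λ') :
    AntitoneOn (fun t => lyapunov Λ' (Λ t)) (Ici 0) := by
  obtain ⟨hnn, x, hx, hstat, hcs⟩ := hΛ'
  intro s hs t _ hst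
  have h := le_sub_mul_of_ae_hasDerivAt_le (ε := 0) hst
    (hΛ.absolutelyContinuous_lyapunov Λ' hs hst) (by
      filter_upwards [hΛ.ae_hasDerivAt_lyapunov hR hw hx.1 hnn hstat hcs] with r hr hsr
      have hr0 : 0 < r := lt_of_le_of_lt hs hsr
      obtain ⟨v, hv, hv'⟩ := hr hr0
      have hnonneg : ∀ p k, 0 ≤ pathPrice R (Λ r) p k * x p k := fun p k =>
        mul_nonneg (pathPrice_nonneg hR (hΛ.nonneg r hr0.le) p k) (hx.1.nonneg p k)
      -- For monotonicity `B` may depend on the time `r`; only the sign of the gap matters.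
      set B : ℝ := 1 + ∑ p, ∑ k, pathPrice R (Λ r) p k * x p k with hB
      have hB0 : 0 < B := add_pos_of_pos_of_nonneg one_pos
        (Finset.sum_nonneg fun p _ => Finset.sum_nonneg fun k _ => hnonneg p k)
      refine ⟨v, hv, (hv' B hB0 fun p k => ?_).trans
        (neg_le_neg (optimalityGap_nonneg hx.1 hB0 (hΛ.nonneg r hr0.le)))⟩
      have h1 := Finset.single_le_sum (f := fun k => pathPrice R (Λ r) p k * x p k)
        (fun k _ => hnonneg p k) (Finset.mem_univ k)
      have h2 := Finset.single_le_sum (f := fun p => ∑ k, pathPrice R (Λ r) p k * x p k)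
        (fun p _ => Finset.sum_nonneg fun k _ => hnonneg p k) (Finset.mem_univ p)
      linarith)
  simpa using h

/-- A trajectory has a cluster point at infinity that is an optimal price vector. -/
lemma IsPriceTrajectory.exists_isOptimalPrice_tendsto_seq (hΛ : IsPriceTrajectory R c w f Λ)
    (hR : ∀ k ℓ p, 0 ≤ R k ℓ p) (hw : ∀ p k, 0 ≤ w p k) {Λ' : L → K → ℝ}
    (hΛ' : IsOptimalPrice R c w f Λ') :
    ∃ Λbar, IsOptimalPrice R c w f Λbar ∧
      ∃ τ : ℕ → ℝ, (∀ n, 0 ≤ τ n) ∧ Tendsto (fun n => Λ (τ n)) atTop (𝓝 Λbar) := by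
  have hanti := hΛ.antitoneOn_lyapunov hR hw hΛ'
  obtain ⟨hnn, x, hx, hstat, hcs⟩ := hΛ'
  set C := Metric.closedBall Λ' √(2 * lyapunov Λ' (Λ 0)) with hC
  have hmem : ∀ t, 0 ≤ t → Λ t ∈ C := fun t ht =>
    Metric.mem_closedBall.2 <| (dist_le_sqrt_lyapunov Λ' (Λ t)).trans <| Real.sqrt_le_sqrt <|
      mul_le_mul_of_nonneg_left (hanti (mem_Ici.2 le_rfl) ht ht) zero_le_two
  have hcomp : IsCompact C := isCompact_closedBall _ _
  obtain ⟨B₀, hB₀⟩ := hcomp.exists_bound_of_continuousOn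
    (f := fun Γ (p : P) (k : K) => pathPrice R Γ p k * x p k)
    (continuous_pi fun p => continuous_pi fun k =>
      (continuous_pathPrice R p k).mul continuous_const).continuousOn
  -- Now `B` must be uniform in time, so that one continuous gap function serves in the limit.
  set B : ℝ := max B₀ 1 with hB
  have hBpos : 0 < B := lt_max_of_lt_right one_pos
  have hle : ∀ t, 0 ≤ t → ∀ p k, pathPrice R (Λ t) p k * x p k ≤ B := fun t ht p k =>
    (le_abs_self _).trans <| (norm_le_pi_norm (fun k => pathPrice R (Λ t) p k * x p k) k).trans <|
      (norm_le_pi_norm (fun (p : P) (k : K) => pathPrice R (Λ t) p k * x p k) p).trans <|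
        (hB₀ _ (hmem t ht)).trans (le_max_left _ _)
  have hsmall : ∀ ε : ℝ, 0 < ε → ∃ t, 0 ≤ t ∧ optimalityGap R c w f x B (Λ t) < ε := by
    intro ε hε
    by_contra! hcon
    -- By time `T`, loss at rate `ε` would push `lyapunov` down to `-1`.
    set T : ℝ := (lyapunov Λ' (Λ 0) + 1) / ε with hT
    have hT0 : 0 ≤ T := div_nonneg (by linarith [lyapunov_nonneg Λ' (Λ 0)]) hε.le
    have h := le_sub_mul_of_ae_hasDerivAt_le (ε := ε) hT0
      (hΛ.absolutelyContinuous_lyapunov Λ' le_rfl hT0) (by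
        filter_upwards [hΛ.ae_hasDerivAt_lyapunov hR hw hx.1 hnn hstat hcs] with r hr hr0
        obtain ⟨v, hv, hv'⟩ := hr hr0
        exact ⟨v, hv, (hv' B hBpos (hle r hr0.le)).trans (neg_le_neg (hcon r hr0.le))⟩)
    rw [sub_zero, hT, mul_div_cancel₀ _ hε.ne'] at h
    linarith [lyapunov_nonneg Λ' (Λ ((lyapunov Λ' (Λ 0) + 1) / ε))]
  choose τ hτ hτgap using fun n : ℕ => hsmall (1 / ((n : ℝ) + 1)) (by positivity)
  obtain ⟨Λbar, -, φ, hφ, hlim⟩ := hcomp.tendsto_subseq fun n => hmem (τ n) (hτ n)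
  refine ⟨Λbar, isOptimalPrice_of_optimalityGap_nonpos hx hBpos (fun ℓ k => ?_) ?_,
    τ ∘ φ, fun n => hτ _, hlim⟩
  · exact ge_of_tendsto' (tendsto_pi_nhds.1 (tendsto_pi_nhds.1 hlim ℓ) k)
      fun n => hΛ.nonneg _ (hτ _) ℓ k
  · exact le_of_tendsto_of_tendsto'
      ((continuous_optimalityGap R c w f x B).continuousAt.tendsto.comp hlim)
      (tendsto_one_div_add_atTop_nhds_zero_nat.comp hφ.tendsto_atTop)
      fun n => (hτgap (φ n)).le

lemma IsPriceTrajectory.exists_tendsto_isOptimalPrice (hΛ : IsPriceTrajectory R c w f Λ)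
    (hR : ∀ k ℓ p, 0 ≤ R k ℓ p) (hc : ∀ ℓ, 0 < c ℓ) (hw : ∀ p k, 0 ≤ w p k)
    (hf : ∀ k, 0 < f k) :
    ∃ Λbar, IsOptimalPrice R c w f Λbar ∧ Tendsto Λ atTop (𝓝 Λbar) := by
  -- The trajectory itself supplies the prices that `exists_isOptimalPrice` needs.
  obtain ⟨t₀, ht₀, hpos⟩ : ∃ t, 0 < t ∧ ∀ p k, 0 < w p k → 0 < pathPrice R (Λ t) p k := by
    have hfreq : ∃ᵐ t : ℝ, t ∈ Ioi (0 : ℝ) := by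
      rw [frequently_ae_mem_iff]
      simp
    obtain ⟨t, ht, h⟩ := (hfreq.and_eventually hΛ.defined).exists
    exact ⟨t, ht, h ht⟩
  obtain ⟨Λ', hΛ'⟩ := exists_isOptimalPrice hR hc hw hf (hΛ.nonneg t₀ ht₀.le) hpos
  obtain ⟨Λbar, hopt, τ, hτ, hlim⟩ := hΛ.exists_isOptimalPrice_tendsto_seq hR hw hΛ'
  -- The reference point is now the cluster point `Λbar` instead of `Λ'`.
  have hanti := hΛ.antitoneOn_lyapunov hR hw hopt
  refine ⟨Λbar, hopt, ?_⟩
  have hseq : Tendsto (fun n => lyapunov Λbar (Λ (τ n))) atTop (𝓝 0) := by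
    have h := (continuous_lyapunov Λbar).continuousAt.tendsto.comp hlim
    rwa [show lyapunov Λbar Λbar = 0 by simp [lyapunov]] at h
  have hV : Tendsto (fun t => lyapunov Λbar (Λ t)) atTop (𝓝 0) := by
    refine tendsto_order.2 ⟨fun a ha => Eventually.of_forall fun t =>
      ha.trans_le (lyapunov_nonneg _ _), fun a ha => ?_⟩
    obtain ⟨n, hn⟩ := (hseq.eventually (gt_mem_nhds ha)).exists
    filter_upwards [eventually_ge_atTop (τ n)] with t ht
    exact (hanti (hτ n) ((hτ n).trans ht) ht).trans_lt hn
  refine tendsto_iff_dist_tendsto_zero.2 (squeeze_zero (fun _ => dist_nonneg)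
    (fun t => dist_le_sqrt_lyapunov Λbar (Λ t)) ?_)
  simpa using (hV.const_mul 2).sqrt

end Trajectory

end LinePlanning

theorem mainTheorem3 {L P K : Type*} [Fintype L] [Fintype P] [Fintype K]
    (R : K → Matrix L P ℝ) (hR : ∀ k ℓ p, R k ℓ p = 0 ∨ R k ℓ p = 1)
    (c : L → ℝ) (hc : ∀ ℓ, 0 < c ℓ)
    (w : P → K → ℝ) (hw : ∀ p k, 0 ≤ w p k)
    (f : K → ℝ) (hf : ∀ k, 0 < f k)
    (Λ : ℝ → L → K → ℝ) (hΛ : LinePlanning.IsPriceTrajectory R c w f Λ) :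
    (∃ Λbar : L → K → ℝ, LinePlanning.IsOptimalPrice R c w f Λbar ∧
      Filter.Tendsto Λ Filter.atTop (nhds Λbar)) ∧
    ∀ Λbar : L → K → ℝ, LinePlanning.IsOptimalPrice R c w f Λbar →
      AntitoneOn (fun t => LinePlanning.lyapunov Λbar (Λ t)) (Set.Ici 0) := by
  have hR0 : ∀ k ℓ p, 0 ≤ R k ℓ p := fun k ℓ p => by
    rcases hR k ℓ p with h | h <;> simp [h]
  exact ⟨hΛ.exists_tendsto_isOptimalPrice hR0 hc hw hf,
    fun _ hopt => hΛ.antitoneOn_lyapunov hR0 hw hopt⟩
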